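/- Let $N\ge 1$ be an integer and $\lambda>0$. Let $h=\mathsf{h}_N^\lambda\in\mathbb{C}^N$ be the periodized, sampled dilated Gaussian \[ h[n]=\sum_{j\in\mathbb{Z}} e^{-\pi\lambda (n/N-j)^2},\qquad n=0,\dots,N-1, \] and for $f\in\mathbb{C}^N$ let \[ \mathbf{V}_h f[k,l]=\sum_{m=0}^{N-1} f[m]\,\overline{h[m-k]}\,e^{-2\pi i l m/N},\qquad k,l\in\{0,\dots,N-1\}, \] be the finite Gabor transform, where the index $m-k$ is taken modulo $N$. Let $K\ge 0$ and let $(j_k,l_k)$, $k=1,\dots,K$, be distinct pairs in $\{0,\dots,N-1\}^2$. The following are equivalent. 1) The set $\{(j_k,l_k)\}_{k=1}^K$ gives rise to a finite Gabor frame for $\mathbb{C}^N$ with window $h$, i.e. there are constants $A,B>0$ such that for every $f\in\mathbb{C}^N$ \[ A\|f\|_{\mathbb{C}^N}^2\le\sum_{k=1}^{K}\bigl|\mathbf{V}_h f[j_k,l_k]\bigr|^2\le B\|f\|_{\mathbb{C}^N}^2 . \] 2) One of the following three conditions holds: (i) $N^2\ge K\ge N+1$; (ii) $K=N$ is odd;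 (iii) $K=N$ is even and $\sum_{k=1}^N (j_k,l_k)\notin N\mathbb{N}^2$, where $N\mathbb{N}^2=\{(Na,Nb): a,b\in\mathbb{N}\}$ and $0\in\mathbb{N}$. -/

import Mathlib

namespace FiniteGabor

/-- The sampled periodization `P_N f = (∑_{j ∈ ℤ} f (n / N - j))_{n = 0, …, N - 1} ∈ ℂ^N`
of a function `f` on the real line. -/
noncomputable def periodizedSamples (N : ℕ) (f : ℝ → ℂ) : EuclideanSpace ℂ (Fin N) :=
  WithLp.toLp 2 fun n : Fin N => ∑' j : ℤ, f (((n : ℕ) : ℝ) / (N : ℝ) - (j : ℝ))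

/-- The dilated Gaussian `t ↦ exp (-π lam t²)`. -/
noncomputable def dilatedGaussian (lam : ℝ) : ℝ → ℂ :=
  fun t => ((Real.exp (-Real.pi * lam * t ^ 2) : ℝ) : ℂ)

/-- The periodized and sampled dilated Gaussian window in `ℂ^N`. -/
noncomputable def gaussianWindow (N : ℕ) (lam : ℝ) : EuclideanSpace ℂ (Fin N) :=
  periodizedSamples N (dilatedGaussian lam)

/-- The finite Gabor transform
`V_g f [k, l] = ∑_{m = 0}^{N - 1} f[m] * conj (g[m - k]) * exp (-2 π i l m / N)`.
Subtraction in `Fin N` is subtraction modulo `N`. -/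
noncomputable def gaborTransform {N : ℕ} (g f : EuclideanSpace ℂ (Fin N)) (k l : Fin N) : ℂ :=
  ∑ m : Fin N, f m * (starRingEnd ℂ) (g (m - k)) *
    Complex.exp (-2 * (Real.pi : ℂ) * Complex.I * ((l : ℕ) : ℂ) * ((m : ℕ) : ℂ) / (N : ℂ))

/-- The index pairs `p 1, …, p K` give rise to a finite Gabor frame for `ℂ^N` with window `g`. -/
def IsGaborFrame {N K : ℕ} (g : EuclideanSpace ℂ (Fin N)) (p : Fin K → Fin N × Fin N) : Prop :=
  ∃ A B : ℝ, 0 < A ∧ 0 < B ∧ ∀ f : EuclideanSpace ℂ (Fin N),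
    A * ‖f‖ ^ 2 ≤ ∑ k : Fin K, ‖gaborTransform g f (p k).1 (p k).2‖ ^ 2 ∧
    ∑ k : Fin K, ‖gaborTransform g f (p k).1 (p k).2‖ ^ 2 ≤ B * ‖f‖ ^ 2

end FiniteGabor

/-!
The Gabor transform of `f` with the periodized Gaussian as window is, up to nonzero factors, the
family of values of the entire function `gaborTheta lam f` at the `N`-torsion points
`k / N - i l / lam` of the torus `ℂ / (ℤ + ℤ τ)`, `τ = i N / lam`. This function is a theta section
of degree `N`: it has period `1` and picks up the factor `exp (π N² / lam) exp (-2 π i N z)` under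
`z ↦ z + τ`. In finite dimension, being a frame means that no nonzero `f` is annihilated by all
the samples (`isGaborFrame_iff`), so the theorem is a statement about the possible zeros of theta
sections of degree `N`.

A nonzero section of degree `N` has at most `N` zeros modulo the lattice, and if `N` distinct zeros
are present, their sum is determined modulo the lattice
(`IsThetaSection.eq_zero_or_of_card_zeros`). No contour integration is used: each zero is divided
out by a translate of the explicit product `thetaProd`, whose zeros are the lattice points and are
simple, until a section of degree zero is left, and Liouville's theorem describes it
(`IsThetaSection.degree_zero`). In the case at hand the sum rule can hold only for even `N`, where it
says that both coordinate sums are divisible by `N` (`zero_sum_condition_iff`,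
`zero_sum_integer_condition_iff`).

Conversely, if `K < N` a dimension count gives a nonzero `f` annihilated by the samples. If `K = N`
is even and the sum rule holds, it gives a nonzero `f` annihilated by all samples but one.
Dividing out its `N - 1` zeros leaves a section of degree one. Such a section vanishes where its
constant predicts (`IsThetaSection.degree_one`), which is at the remaining point
(`IsThetaSection.eq_zero_of_sum_zeros`).
-/

namespace FiniteGabor

open Complex Filter Topology

/-! ### The infinite product `∏ (1 - qⁿ w)` -/

/-- The Euler product `∏_{n ≥ 0} (1 - qⁿ w)`, entire in `w` when `‖q‖ < 1`. The factors are
written as `1 + _`, the form in which Mathlib treats convergence of infinite products. -/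
noncomputable def eulerProd (q w : ℂ) : ℂ := ∏' n : ℕ, (1 + -(q ^ n * w))

lemma summable_norm_eulerProd_term {q : ℂ} (hq : ‖q‖ < 1) (w : ℂ) :
    Summable fun n : ℕ => ‖-(q ^ n * w)‖ := by
  simpa using (summable_geometric_of_lt_one (norm_nonneg q) hq).mul_right ‖w‖

lemma differentiable_eulerProd {q : ℂ} (hq : ‖q‖ < 1) : Differentiable ℂ (eulerProd q) := by
  intro w
  have hprod : HasProdLocallyUniformlyOn (fun (n : ℕ) (x : ℂ) => 1 + -(q ^ n * x)) (eulerProd q)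
      (Metric.ball 0 (‖w‖ + 1)) := by
    refine Summable.hasProdLocallyUniformlyOn_nat_one_add Metric.isOpen_ball
      (u := fun n => ‖q‖ ^ n * (‖w‖ + 1))
      ((summable_geometric_of_lt_one (norm_nonneg q) hq).mul_right _) ?_ ?_
    · refine Eventually.of_forall fun n x hx => ?_
      have hx' : ‖x‖ ≤ ‖w‖ + 1 := by simpa using (mem_ball_zero_iff.mp hx).le
      rw [norm_neg, norm_mul, norm_pow]
      gcongr
    · intro n
      fun_prop
  refine (hprod.differentiableOn (Eventually.of_forall fun s => ?_)
    Metric.isOpen_ball).differentiableAt (Metric.isOpen_ball.mem_nhds (by simp))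
  simpa [Finset.prod_fn] using DifferentiableOn.finsetProd (fun _ _ ↦ by fun_prop)

lemma eulerProd_eq_mul {q : ℂ} (hq : ‖q‖ < 1) (w : ℂ) :
    eulerProd q w = (1 - w) * eulerProd q (q * w) := by
  have h : Multipliable fun n : ℕ => 1 + -(q ^ (n + 1) * w) := by
    apply multipliable_one_add_of_summable
    exact (summable_nat_add_iff (f := fun n => ‖-(q ^ n * w)‖) 1).mpr
      (summable_norm_eulerProd_term hq w)
  have h2 : (∏' n : ℕ, (1 + -(q ^ (n + 1) * w))) = eulerProd q (q * w) :=
    tprod_congr fun n => by ring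
  have h3 : eulerProd q w = (1 + -(q ^ 0 * w)) * ∏' n : ℕ, (1 + -(q ^ (n + 1) * w)) :=
    tprod_eq_zero_mul' (f := fun n : ℕ => 1 + -(q ^ n * w)) h
  rw [h3, h2, pow_zero, one_mul, sub_eq_add_neg]

lemma exists_of_eulerProd_eq_zero {q w : ℂ} (hq : ‖q‖ < 1) (h : eulerProd q w = 0) :
    ∃ n : ℕ, q ^ n * w = 1 := by
  by_contra! hn
  refine tprod_one_add_ne_zero_of_summable (f := fun n : ℕ => -(q ^ n * w)) (fun n h0 => ?_)
    (summable_norm_eulerProd_term hq w) h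
  exact hn n (add_neg_eq_zero.mp h0).symm

/-! ### A theta function with simple zeros at a lattice -/

/-- A function periodic with respect to `1` and `τ` is periodic with respect to `ℤ + ℤ τ`. -/
lemma lattice_invariant {α : Type*} {τ : ℂ} {Q : ℂ → α} (h1 : ∀ z, Q (z + 1) = Q z)
    (hτ : ∀ z, Q (z + τ) = Q z) (m k : ℤ) (z : ℂ) : Q (z + m + k * τ) = Q z := by
  have e1 : Function.Periodic Q 1 := h1
  have eτ : Function.Periodic Q τ := hτ
  have h2 := eτ.int_mul k (z + m)
  have h3 := e1.int_mul m z
  rw [mul_one] at h3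
  rw [h2, h3]

/-- The theta function `∏_{n ≥ 0} (1 - qⁿ w) · ∏_{n ≥ 1} (1 - qⁿ / w)`, with `w = exp (2 π i z)`
and `q = exp (2 π i τ)`. -/
noncomputable def thetaProd (τ z : ℂ) : ℂ :=
  eulerProd (exp (2 * Real.pi * I * τ)) (exp (2 * Real.pi * I * z)) *
    eulerProd (exp (2 * Real.pi * I * τ)) (exp (2 * Real.pi * I * (τ - z)))

lemma norm_nome_lt_one {τ : ℂ} (hτ : 0 < τ.im) : ‖exp (2 * Real.pi * I * τ)‖ < 1 := by
  rw [norm_exp, Real.exp_lt_one_iff]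
  simp
  positivity

lemma differentiable_thetaProd {τ : ℂ} (hτ : 0 < τ.im) : Differentiable ℂ (thetaProd τ) := by
  have hd := differentiable_eulerProd (norm_nome_lt_one hτ)
  unfold thetaProd
  exact (hd.comp (by fun_prop)).mul (hd.comp (by fun_prop))

lemma exp_two_pi_add_one (z : ℂ) : exp (2 * Real.pi * I * (z + 1)) = exp (2 * Real.pi * I * z) := by
  rw [mul_add, mul_one, exp_periodic]

lemma thetaProd_add_one (τ z : ℂ) : thetaProd τ (z + 1) = thetaProd τ z := by
  unfold thetaProd
  rw [exp_two_pi_add_one, ← exp_two_pi_add_one (τ - (z + 1))]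
  congr 4
  ring

lemma thetaProd_add_tau {τ : ℂ} (hτ : 0 < τ.im) (z : ℂ) :
    thetaProd τ (z + τ) = -exp (-(2 * Real.pi * I * z)) * thetaProd τ z := by
  have hq := norm_nome_lt_one hτ
  unfold thetaProd
  have e1 : exp (2 * Real.pi * I * (z + τ)) =
      exp (2 * Real.pi * I * τ) * exp (2 * Real.pi * I * z) := by rw [← exp_add]; ring_nf
  have e2 : exp (2 * Real.pi * I * (τ - z)) =
      exp (2 * Real.pi * I * τ) * exp (-(2 * Real.pi * I * z)) := by rw [← exp_add]; ring_nf
  have e3 : exp (2 * Real.pi * I * (τ - (z + τ))) = exp (-(2 * Real.pi * I * z)) := by ring_nf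
  have e4 : exp (-(2 * Real.pi * I * z)) * exp (2 * Real.pi * I * z) = 1 := by
    rw [← exp_add]; simp
  rw [e1, e2, e3, eulerProd_eq_mul hq (exp (2 * Real.pi * I * z)),
    eulerProd_eq_mul hq (exp (-(2 * Real.pi * I * z)))]
  linear_combination (eulerProd (exp (2 * Real.pi * I * τ))
    (exp (2 * Real.pi * I * τ) * exp (2 * Real.pi * I * z)) *
      eulerProd (exp (2 * Real.pi * I * τ))
    (exp (2 * Real.pi * I * τ) * exp (-(2 * Real.pi * I * z)))) * (-e4)

lemma exists_of_thetaProd_eq_zero {τ z : ℂ} (hτ : 0 < τ.im) (h : thetaProd τ z = 0) :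
    ∃ m k : ℤ, z = m + k * τ := by
  have hq := norm_nome_lt_one hτ
  have hpi := two_pi_I_ne_zero
  rcases mul_eq_zero.mp h with h | h
  · obtain ⟨n, hn⟩ := exists_of_eulerProd_eq_zero hq h
    rw [← exp_nat_mul, ← exp_add, exp_eq_one_iff] at hn
    obtain ⟨m, hm⟩ := hn
    refine ⟨m, -n, mul_left_cancel₀ hpi ?_⟩
    push_cast
    linear_combination hm
  · obtain ⟨n, hn⟩ := exists_of_eulerProd_eq_zero hq h
    rw [← exp_nat_mul, ← exp_add, exp_eq_one_iff] at hn
    obtain ⟨m, hm⟩ := hn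
    refine ⟨-m, n + 1, mul_left_cancel₀ hpi ?_⟩
    push_cast
    linear_combination -hm

lemma eulerProd_nome_ne_zero {τ : ℂ} (hτ : 0 < τ.im) :
    eulerProd (exp (2 * Real.pi * I * τ)) (exp (2 * Real.pi * I * τ)) ≠ 0 := by
  have hq := norm_nome_lt_one hτ
  intro h
  obtain ⟨n, hn⟩ := exists_of_eulerProd_eq_zero hq h
  have h2 : ‖exp (2 * Real.pi * I * τ)‖ ^ (n + 1) < 1 :=
    pow_lt_one₀ (norm_nonneg _) hq (Nat.succ_ne_zero n)
  rw [← norm_pow, pow_succ, hn, norm_one] at h2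
  exact lt_irrefl _ h2

lemma thetaProd_zero {τ : ℂ} (hτ : 0 < τ.im) : thetaProd τ 0 = 0 := by
  unfold thetaProd
  rw [eulerProd_eq_mul (norm_nome_lt_one hτ) (exp (2 * Real.pi * I * 0))]
  simp

lemma deriv_thetaProd_zero_ne_zero {τ : ℂ} (hτ : 0 < τ.im) : deriv (thetaProd τ) 0 ≠ 0 := by
  have hq := norm_nome_lt_one hτ
  have hd := differentiable_eulerProd hq
  set R : ℂ → ℂ := fun z => eulerProd (exp (2 * Real.pi * I * τ))
      (exp (2 * Real.pi * I * τ) * exp (2 * Real.pi * I * z)) *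
    eulerProd (exp (2 * Real.pi * I * τ)) (exp (2 * Real.pi * I * (τ - z))) with hR
  have hRd : Differentiable ℂ R := (hd.comp (by fun_prop)).mul (hd.comp (by fun_prop))
  have hfac : thetaProd τ = fun z => (1 - exp (2 * Real.pi * I * z)) * R z := by
    funext z
    simp only [hR, thetaProd]
    rw [eulerProd_eq_mul hq (exp (2 * Real.pi * I * z))]
    ring
  have h1 : HasDerivAt (fun z : ℂ => 1 - exp (2 * Real.pi * I * z)) (-(2 * Real.pi * I)) 0 := by
    have := (((hasDerivAt_id (0 : ℂ)).const_mul (2 * Real.pi * I)).cexp).const_sub 1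
    simpa using this
  have h2 := h1.mul (hRd 0).hasDerivAt
  rw [hfac]
  have h3 := h2.deriv
  change deriv (fun z => (1 - exp (2 * Real.pi * I * z)) * R z) 0 = _ at h3
  rw [h3]
  have h4 := eulerProd_nome_ne_zero hτ
  simp [hR, h4]

/-- The lattice points are simple zeros of `thetaProd τ`: the claim at `0` is read off from the factor
`1 - w`, and quasi-periodicity transports it to the other lattice points. -/
lemma thetaProd_simple_zero {τ : ℂ} (hτ : 0 < τ.im) (m k : ℤ) :
    thetaProd τ (m + k * τ) = 0 ∧ deriv (thetaProd τ) (m + k * τ) ≠ 0 := by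
  have key := lattice_invariant (τ := τ)
    (Q := fun z => thetaProd τ z = 0 ∧ deriv (thetaProd τ) z ≠ 0) ?_ ?_ m k 0
  · rw [zero_add] at key
    rw [key]
    exact ⟨thetaProd_zero hτ, deriv_thetaProd_zero_ne_zero hτ⟩
  · intro z
    have : deriv (thetaProd τ) (z + 1) = deriv (thetaProd τ) z := by
      rw [← deriv_comp_add_const]
      simp only [thetaProd_add_one]
    rw [thetaProd_add_one, this]
  · intro z
    have hd : deriv (thetaProd τ) (z + τ) =
        deriv (fun z => -exp (-(2 * Real.pi * I * z)) * thetaProd τ z) z := by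
      rw [← deriv_comp_add_const]
      simp only [thetaProd_add_tau hτ]
    have hmul := deriv_fun_mul (c := fun z => -exp (-(2 * Real.pi * I * z))) (d := thetaProd τ)
      (x := z) (by fun_prop) (differentiable_thetaProd hτ z)
    have he : -exp (-(2 * Real.pi * I * z)) ≠ 0 := neg_ne_zero.mpr (exp_ne_zero _)
    rw [hd, hmul, thetaProd_add_tau hτ]
    refine propext ⟨fun ⟨h0, h⟩ => ?_, fun ⟨h0, h⟩ => ?_⟩
    · have h0' : thetaProd τ z = 0 := (mul_eq_zero.mp h0).resolve_left he
      refine ⟨h0', fun h' => h ?_⟩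
      rw [h0', h']
      simp
    · rw [h0]
      simpa using h

lemma thetaProd_eq_zero_iff {τ z : ℂ} (hτ : 0 < τ.im) :
    thetaProd τ z = 0 ↔ ∃ m k : ℤ, z = m + k * τ :=
  ⟨exists_of_thetaProd_eq_zero hτ, by
    rintro ⟨m, k, rfl⟩
    exact (thetaProd_simple_zero hτ m k).1⟩

/-! ### Entire quotients and theta sections -/

/-- An entire function that vanishes at the zeros of another entire function, all of which are
simple, is divisible by it. -/
lemma exists_entire_quotient {F P : ℂ → ℂ} (hF : Differentiable ℂ F) (hP : Differentiable ℂ P)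
    (h0 : ∀ z, P z = 0 → F z = 0 ∧ deriv P z ≠ 0) :
    ∃ G : ℂ → ℂ, Differentiable ℂ G ∧ ∀ z, F z = P z * G z := by
  classical
  set G : ℂ → ℂ := fun z => if P z = 0 then deriv F z / deriv P z else F z / P z with hG
  refine ⟨G, fun a => ?_, fun z => ?_⟩
  · by_cases ha : P a = 0
    · obtain ⟨hFa, hda⟩ := h0 a ha
      have dF : DifferentiableAt ℂ (dslope F a) a :=
        ((differentiableOn_dslope univ_mem).mpr hF.differentiableOn).differentiableAt univ_mem
      have dP : DifferentiableAt ℂ (dslope P a) a :=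
        ((differentiableOn_dslope univ_mem).mpr hP.differentiableOn).differentiableAt univ_mem
      have hne : dslope P a a ≠ 0 := by rwa [dslope_same]
      refine (dF.div dP hne).congr_of_eventuallyEq ?_
      filter_upwards [dP.continuousAt.eventually_ne hne] with z hz
      rcases eq_or_ne z a with rfl | hza
      · simp [hG, ha, dslope_same]
      · have hza' := sub_ne_zero.mpr hza
        have eP : P z = (z - a) * dslope P a z := by
          rw [dslope_of_ne _ hza, slope_def_field, ha]; field_simp; simp
        have eF : F z = (z - a) * dslope F a z := by
          rw [dslope_of_ne _ hza, slope_def_field, hFa]; field_simp; simp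
        have hPz : P z ≠ 0 := by rw [eP]; exact mul_ne_zero hza' hz
        simp only [hG, if_neg hPz, Pi.div_apply]
        rw [eP, eF, mul_div_mul_left _ _ hza']
    · refine ((hF a).div (hP a) ha).congr_of_eventuallyEq ?_
      filter_upwards [(hP a).continuousAt.eventually_ne ha] with z hz
      simp [hG, hz]
  · by_cases hz : P z = 0
    · simp [hz, (h0 z hz).1]
    · simp only [hG, if_neg hz]
      field_simp

lemma entire_mul_left_cancel {P A B : ℂ → ℂ} (hP : Differentiable ℂ P) (hA : Differentiable ℂ A)
    (hB : Differentiable ℂ B) (hne : ∃ z, P z ≠ 0) (h : ∀ z, P z * A z = P z * B z) (z : ℂ) :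
    A z = B z := by
  have an : ∀ {f : ℂ → ℂ}, Differentiable ℂ f → AnalyticOnNhd ℂ f Set.univ :=
    fun hf => hf.differentiableOn.analyticOnNhd isOpen_univ
  rcases AnalyticOnNhd.eq_zero_or_eq_zero_of_mul_eq_zero (an hP) (an (hA.sub hB))
    (fun z _ => by simp [mul_sub, h z]) isPreconnected_univ with h | h
  · obtain ⟨w, hw⟩ := hne
    exact absurd (h w trivial) hw
  · exact sub_eq_zero.mp (h z trivial)

/-- Entire functions `F` with `F (z + 1) = F z` and `F (z + τ) = c exp (-2 π i n z) F z`: sections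
of a line bundle of degree `n` on the torus `ℂ / (ℤ + ℤ τ)`, the bundle being recorded
by its degree and the constant `c`. -/
structure IsThetaSection (τ : ℂ) (n : ℕ) (c : ℂ) (F : ℂ → ℂ) : Prop where
  differentiable : Differentiable ℂ F
  add_one : ∀ z, F (z + 1) = F z
  add_tau : ∀ z, F (z + τ) = c * exp (-(2 * Real.pi * I * n * z)) * F z

namespace IsThetaSection

variable {τ : ℂ} {n : ℕ} {c : ℂ} {F : ℂ → ℂ}

lemma eq_zero_iff_add_lattice (hF : IsThetaSection τ n c F) (z : ℂ) (m k : ℤ) :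
    F (z + m + k * τ) = 0 ↔ F z = 0 := by
  refine Iff.of_eq (lattice_invariant (τ := τ) (Q := fun z => F z = 0) (fun z => ?_)
    (fun z => ?_) m k z)
  · rw [hF.add_one]
  · rw [hF.add_tau]
    by_cases hc : c = 0
    · have hz : F z = 0 := by
        have := hF.add_tau (z - τ)
        simpa [hc] using this
      simp [hz]
    · simp [hc]

/-- Dividing a section by the theta function with simple zeros at `a + ℤ + ℤ τ`. -/
lemma exists_quotient (hτ : 0 < τ.im) (hF : IsThetaSection τ (n + 1) c F) {a : ℂ}
    (ha : F a = 0) :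
    ∃ G, IsThetaSection τ n (-c * exp (-(2 * Real.pi * I * a))) G ∧
      ∀ z, F z = thetaProd τ (z - a) * G z := by
  have hP : Differentiable ℂ fun z => thetaProd τ (z - a) :=
    (differentiable_thetaProd hτ).comp (by fun_prop)
  obtain ⟨G, hG, hFG⟩ := exists_entire_quotient hF.differentiable hP (fun z hz => by
    obtain ⟨m, k, hmk⟩ := (thetaProd_eq_zero_iff hτ).mp hz
    refine ⟨?_, ?_⟩
    · have := (hF.eq_zero_iff_add_lattice a m k).mpr ha
      rwa [show a + m + k * τ = z by linear_combination -hmk] at this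
    · rw [deriv_comp_sub_const, hmk]
      exact (thetaProd_simple_zero hτ m k).2)
  have hne : ∃ z, thetaProd τ (z - a) ≠ 0 := by
    by_contra! h
    have h' : thetaProd τ = fun _ => 0 := by
      funext z
      simpa using h (z + a)
    exact deriv_thetaProd_zero_ne_zero hτ (by rw [h']; simp)
  refine ⟨G, ⟨hG, ?_, ?_⟩, hFG⟩
  · refine entire_mul_left_cancel hP (hG.comp (by fun_prop)) hG hne fun z => ?_
    have h1 := hF.add_one z
    rw [hFG, hFG, show z + 1 - a = z - a + 1 by ring, thetaProd_add_one] at h1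
    exact h1
  · refine entire_mul_left_cancel hP (hG.comp (by fun_prop)) (by fun_prop) hne fun z => ?_
    have h1 := hF.add_tau z
    rw [hFG, hFG, show z + τ - a = z - a + τ by ring, thetaProd_add_tau hτ] at h1
    have e1 : exp (2 * Real.pi * I * (z - a)) * exp (-(2 * Real.pi * I * (z - a))) = 1 := by
      rw [← exp_add]; simp
    have e2 : exp (2 * Real.pi * I * (z - a)) * exp (-(2 * Real.pi * I * (n + 1 : ℕ) * z)) =
        exp (-(2 * Real.pi * I * a)) * exp (-(2 * Real.pi * I * n * z)) := by
      rw [← exp_add, ← exp_add]; push_cast; ring_nf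
    linear_combination (-exp (2 * Real.pi * I * (z - a))) * h1 -
      thetaProd τ (z - a) * G (z + τ) * e1 - (c * thetaProd τ (z - a) * G z) * e2

end IsThetaSection

/-- A continuous function whose norm is invariant under a lattice is bounded. -/
lemma bounded_of_norm_lattice_invariant {τ : ℂ} (hτ : 0 < τ.im) {H : ℂ → ℂ} (hH : Continuous H)
    (h1 : ∀ z, ‖H (z + 1)‖ = ‖H z‖) (h2 : ∀ z, ‖H (z + τ)‖ = ‖H z‖) :
    Bornology.IsBounded (Set.range H) := by
  have hK : IsCompact (Set.Icc (0 : ℝ) 1 ×ℂ Set.Icc 0 τ.im) := isCompact_Icc.reProdIm isCompact_Icc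
  obtain ⟨C, hC⟩ := hK.exists_bound_of_continuousOn hH.continuousOn
  rw [isBounded_iff_forall_norm_le]
  refine ⟨C, ?_⟩
  rintro _ ⟨z, rfl⟩
  set k : ℤ := ⌊z.im / τ.im⌋ with hk
  set m : ℤ := ⌊z.re - k * τ.re⌋ with hm
  have key := lattice_invariant (Q := fun z => ‖H z‖) h1 h2 (-m) (-k) z
  rw [← key]
  refine hC _ ?_
  have hk1 := Int.floor_le (z.im / τ.im)
  have hk2 := Int.lt_floor_add_one (z.im / τ.im)
  rw [← hk] at hk1 hk2
  rw [le_div_iff₀ hτ] at hk1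
  rw [div_lt_iff₀ hτ] at hk2
  have hm1 := Int.floor_le (z.re - k * τ.re)
  have hm2 := Int.lt_floor_add_one (z.re - k * τ.re)
  rw [← hm] at hm1 hm2
  rw [Complex.mem_reProdIm]
  constructor
  · simp
    constructor <;> linarith
  · simp
    constructor <;> linarith

/-- By Liouville's theorem, a section of degree zero is an exponential: either it vanishes
identically, or its constant is a power of `exp (2 π i τ)` and it has no zeros. -/
lemma IsThetaSection.degree_zero {τ c : ℂ} {G : ℂ → ℂ} (hτ : 0 < τ.im)
    (hG : IsThetaSection τ 0 c G) :
    (∀ z, G z = 0) ∨ ((∃ k : ℤ, c = exp (2 * Real.pi * I * (k * τ))) ∧ ∀ z, G z ≠ 0) := by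
  have hadd : ∀ z, G (z + τ) = c * G z := fun z => by simpa using hG.add_tau z
  by_cases hc : c = 0
  · left
    intro z
    simpa [hc] using hadd (z - τ)
  -- `α` is chosen so that the norm of `exp (i α z) G z` is invariant under `z ↦ z + τ`.
  set α : ℝ := Real.log ‖c‖ / τ.im with hα
  set H : ℂ → ℂ := fun z => exp (I * α * z) * G z with hH
  have hnc : ‖exp (I * α * τ)‖ * ‖c‖ = 1 := by
    have hre : (I * α * τ).re = -Real.log ‖c‖ := by
      have : α * τ.im = Real.log ‖c‖ := by rw [hα]; field_simp
      simp [this]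
    rw [norm_exp, hre, Real.exp_neg, Real.exp_log (norm_pos_iff.mpr hc)]
    exact inv_mul_cancel₀ (norm_ne_zero_iff.mpr hc)
  have hHd : Differentiable ℂ H := by
    have := hG.differentiable
    fun_prop
  have hb := bounded_of_norm_lattice_invariant hτ hHd.continuous (fun z => by
    simp only [hH]
    rw [hG.add_one, mul_add, exp_add, norm_mul, norm_mul, norm_mul]
    have : ‖exp (I * α * 1)‖ = 1 := by rw [norm_exp]; simp
    rw [this, mul_one]) (fun z => by
    simp only [hH]
    rw [hadd, mul_add, exp_add, norm_mul, norm_mul, norm_mul, norm_mul]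
    linear_combination (‖exp (I * α * z)‖ * ‖G z‖) * hnc)
  obtain ⟨A, hA⟩ := hHd.exists_const_forall_eq_of_bounded hb
  by_cases hA0 : A = 0
  · left
    intro z
    have := hA z
    rw [hA0] at this
    exact (mul_eq_zero.mp this).resolve_left (exp_ne_zero _)
  right
  have hGne : ∀ z, G z ≠ 0 := fun z h => hA0 (by rw [← hA z]; simp [hH, h])
  refine ⟨?_, hGne⟩
  have h01 : exp (I * α) = 1 := by
    have e : H 1 = H 0 := by rw [hA, hA]
    have g : G 1 = G 0 := by simpa using hG.add_one 0
    simp only [hH, g] at e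
    have := mul_right_cancel₀ (hGne 0) e
    simpa using this
  have h0τ : exp (I * α * τ) * c = 1 := by
    have e : H τ = H 0 := by rw [hA, hA]
    have g : G τ = c * G 0 := by simpa using hadd 0
    simp only [hH, g, ← mul_assoc] at e
    have := mul_right_cancel₀ (hGne 0) e
    simpa using this
  obtain ⟨k, hk⟩ := exp_eq_one_iff.mp h01
  refine ⟨-k, ?_⟩
  have : exp (2 * Real.pi * I * ((-k : ℤ) * τ)) * exp (I * α * τ) = 1 := by
    rw [← exp_add, hk]
    push_cast
    ring_nf
    simp
  exact mul_left_cancel₀ (exp_ne_zero (I * α * τ)) (by rw [h0τ, mul_comm, this])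

/-- A section of degree one has a zero where its constant predicts one. The symmetrization
of the centred section under `z ↦ -z` is again a section of degree one; it vanishes at the
two half-periods `1 / 2` and `τ / 2`, hence identically, and its value at `0` is twice that of the
section. -/
lemma IsThetaSection.degree_one {τ a : ℂ} {G : ℂ → ℂ} (hτ : 0 < τ.im)
    (hG : IsThetaSection τ 1 (-exp (2 * Real.pi * I * a)) G) : G a = 0 := by
  set H : ℂ → ℂ := fun z => G (z + a) with hH
  have hHd : Differentiable ℂ H := hG.differentiable.comp (by fun_prop)
  have hH1 : ∀ z, H (z + 1) = H z := fun z => by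
    simp only [hH]
    rw [show z + 1 + a = z + a + 1 by ring, hG.add_one]
  have hHτ : ∀ z, H (z + τ) = -exp (-(2 * Real.pi * I * z)) * H z := fun z => by
    simp only [hH]
    rw [show z + τ + a = z + a + τ by ring, hG.add_tau, neg_mul, ← exp_add]
    push_cast
    ring_nf
  set E : ℂ → ℂ := fun z => H z + exp (2 * Real.pi * I * z) * H (-z) with hE
  have hEs : IsThetaSection τ 1 (-1) E := by
    refine ⟨by fun_prop, fun z => ?_, fun z => ?_⟩
    · have h := hH1 (-(z + 1))
      rw [show -(z + 1) + 1 = -z by ring] at h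
      simp only [hE]
      rw [hH1, exp_two_pi_add_one, h]
    · have h := hHτ (-(z + τ))
      rw [show -(z + τ) + τ = -z by ring] at h
      simp only [hE]
      rw [hHτ, h]
      have e1 : exp (-(2 * Real.pi * I * -(z + τ))) = exp (2 * Real.pi * I * (z + τ)) := by
        ring_nf
      have e2 : exp (-(2 * Real.pi * I * z)) * exp (2 * Real.pi * I * z) = 1 := by
        rw [← exp_add]; simp
      rw [e1]
      push_cast
      rw [mul_one]
      linear_combination (-exp (2 * Real.pi * I * (z + τ)) * H (-(z + τ))) * e2
  have hE_half : E (1 / 2) = 0 := by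
    have h := hH1 (-(1 / 2))
    rw [show -(1 / 2) + 1 = (1 / 2 : ℂ) by ring] at h
    simp only [hE]
    rw [h, show 2 * Real.pi * I * (1 / 2) = Real.pi * I by ring, exp_pi_mul_I]
    ring
  have hE_tau : E (τ / 2) = 0 := by
    have h := hHτ (-(τ / 2))
    rw [show -(τ / 2) + τ = τ / 2 by ring,
      show -(2 * Real.pi * I * -(τ / 2)) = 2 * Real.pi * I * (τ / 2) by ring] at h
    simp only [hE]
    rw [h]
    ring
  obtain ⟨G₀, hG₀, hEG⟩ := IsThetaSection.exists_quotient hτ hEs hE_half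
  have h0 : E 0 = 0 := by
    rcases hG₀.degree_zero hτ with h | ⟨-, h⟩
    · rw [hEG, h, mul_zero]
    · exfalso
      rw [hEG] at hE_tau
      obtain ⟨m, k, hmk⟩ := (thetaProd_eq_zero_iff hτ).mp
        ((mul_eq_zero.mp hE_tau).resolve_right (h _))
      have him := congrArg Complex.im hmk
      simp at him
      have h2 : τ.im * (1 - 2 * k) = 0 := by linear_combination 2 * him
      have h3 : (1 - 2 * k : ℝ) = 0 := (mul_eq_zero.mp h2).resolve_left hτ.ne'
      have h4 : (1 - 2 * k : ℤ) = 0 := by exact_mod_cast h3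
      omega
  have : H 0 + H 0 = 0 := by simpa [hE] using h0
  have h00 : H 0 = 0 := by simpa using this
  simpa [hH] using h00

namespace IsThetaSection

variable {τ : ℂ} {n : ℕ} {c : ℂ} {F : ℂ → ℂ}

/-- Dividing out finitely many zeros that are distinct modulo the lattice. -/
lemma exists_quotient_finset {ι : Type*} (hτ : 0 < τ.im) (z : ι → ℂ)
    (hz : ∀ i j, i ≠ j → ∀ m k : ℤ, z i - z j ≠ m + k * τ) (s : Finset ι) (n : ℕ)
    (hF : IsThetaSection τ (n + s.card) c F) (h0 : ∀ i ∈ s, F (z i) = 0) :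
    ∃ G, IsThetaSection τ n ((-1) ^ s.card * c * exp (-(2 * Real.pi * I * ∑ i ∈ s, z i))) G ∧
      ∀ x, F x = (∏ i ∈ s, thetaProd τ (x - z i)) * G x := by
  classical
  induction s using Finset.induction_on generalizing n with
  | empty => exact ⟨F, by simpa using hF, by simp⟩
  | insert a s ha ih =>
    rw [Finset.card_insert_of_notMem ha] at hF ⊢
    obtain ⟨G, hG, hFG⟩ := ih (n + 1) (by rwa [add_assoc, add_comm 1])
      (fun i hi => h0 i (Finset.mem_insert_of_mem hi))
    have hGa : G (z a) = 0 := by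
      have h := h0 a (Finset.mem_insert_self a s)
      rw [hFG] at h
      refine (mul_eq_zero.mp h).resolve_left (Finset.prod_ne_zero_iff.mpr fun i hi hP => ?_)
      obtain ⟨m, k, hmk⟩ := (thetaProd_eq_zero_iff hτ).mp hP
      exact hz a i (fun e => ha (e ▸ hi)) m k hmk
    obtain ⟨G', hG', hGG'⟩ := hG.exists_quotient hτ hGa
    refine ⟨G', ?_, fun x => ?_⟩
    · convert hG' using 1
      rw [Finset.sum_insert ha, mul_add, neg_add, exp_add, pow_succ]
      ring
    · rw [hFG, hGG', Finset.prod_insert ha]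
      ring

/-- A nonzero section of degree `n` with `n` zeros that are distinct modulo the lattice has no
further zero, and the sum of its zeros is determined modulo the lattice by its constant. -/
lemma eq_zero_or_of_card_zeros {ι : Type*} (hτ : 0 < τ.im) (z : ι → ℂ)
    (hz : ∀ i j, i ≠ j → ∀ m k : ℤ, z i - z j ≠ m + k * τ) (s : Finset ι)
    (hF : IsThetaSection τ s.card c F) (h0 : ∀ i ∈ s, F (z i) = 0) :
    (∀ x, F x = 0) ∨ ((∀ i, i ∉ s → F (z i) ≠ 0) ∧
      ∃ k : ℤ, (-1) ^ s.card * c * exp (-(2 * Real.pi * I * ∑ i ∈ s, z i)) =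
        exp (2 * Real.pi * I * (k * τ))) := by
  obtain ⟨G, hG, hFG⟩ := exists_quotient_finset hτ z hz s 0 (by rwa [zero_add]) h0
  rcases hG.degree_zero hτ with h | ⟨hk, h⟩
  · left
    intro x
    rw [hFG, h, mul_zero]
  · refine Or.inr ⟨fun j hj => ?_, hk⟩
    rw [hFG]
    refine mul_ne_zero (Finset.prod_ne_zero_iff.mpr fun i hi hP => ?_) (h _)
    obtain ⟨m, k, hmk⟩ := (thetaProd_eq_zero_iff hτ).mp hP
    exact hz j i (fun e => hj (e ▸ hi)) m k hmk

/-- A section of degree `n` that vanishes at `n - 1` points, distinct modulo the lattice, also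
vanishes at the point that completes them to the sum prescribed by its constant. -/
lemma eq_zero_of_sum_zeros {ι : Type*} [DecidableEq ι] (hτ : 0 < τ.im) (z : ι → ℂ)
    (hz : ∀ i j, i ≠ j → ∀ m k : ℤ, z i - z j ≠ m + k * τ) (s : Finset ι) {a : ι} (ha : a ∉ s)
    (hF : IsThetaSection τ (s.card + 1) c F) (h0 : ∀ i ∈ s, F (z i) = 0) {k : ℤ}
    (hk : (-1) ^ (s.card + 1) * c * exp (-(2 * Real.pi * I * ∑ i ∈ insert a s, z i)) =
      exp (2 * Real.pi * I * (k * τ))) : F (z a) = 0 := by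
  obtain ⟨G, hG, hFG⟩ := exists_quotient_finset hτ z hz s 1 (by rwa [add_comm]) h0
  have hc : (-1) ^ s.card * c * exp (-(2 * Real.pi * I * ∑ i ∈ s, z i)) =
      -exp (2 * Real.pi * I * (z a + k * τ)) := by
    rw [mul_add, exp_add, ← hk, Finset.sum_insert ha, mul_add, neg_add, exp_add, exp_neg, exp_neg]
    field_simp
    ring
  rw [hc] at hG
  have hGa := hG.degree_one hτ
  have hGz := (hG.eq_zero_iff_add_lattice (z a) 0 k).mp (by simpa using hGa)
  rw [hFG, hGz, mul_zero]

end IsThetaSection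

/-! ### The Gabor transform as samples of a theta section -/

/-- The periodized Gaussian `∑_j exp (-π lam (u - j)²)`, continued to complex arguments and written
through the Jacobi theta function. -/
noncomputable def periodicGaussian (lam : ℝ) (u : ℂ) : ℂ :=
  exp (-Real.pi * lam * u ^ 2) * jacobiTheta₂ (-I * lam * u) (I * lam)

lemma differentiable_periodicGaussian {lam : ℝ} (hlam : 0 < lam) :
    Differentiable ℂ (periodicGaussian lam) := by
  intro u
  have him : 0 < (I * lam : ℂ).im := by simpa using hlam
  have h := (differentiableAt_jacobiTheta₂_fst (-I * lam * u) him).comp u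
    (f := fun u : ℂ => -I * lam * u) (by fun_prop)
  exact DifferentiableAt.mul (by fun_prop) h

lemma periodicGaussian_add_one (lam : ℝ) (u : ℂ) :
    periodicGaussian lam (u + 1) = periodicGaussian lam u := by
  have h := jacobiTheta₂_add_left' (-I * lam * (u + 1)) (I * lam)
  rw [show -I * lam * (u + 1) + I * lam = -I * lam * u by ring] at h
  unfold periodicGaussian
  rw [h, ← mul_assoc, ← exp_add]
  congr 2
  linear_combination (-(Real.pi * lam * (1 + 2 * u))) * I_sq

lemma periodicGaussian_add_intCast (lam : ℝ) (u : ℂ) (j : ℤ) :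
    periodicGaussian lam (u + j) = periodicGaussian lam u := by
  have h : Function.Periodic (periodicGaussian lam) 1 := periodicGaussian_add_one lam
  simpa using h.int_mul j u

lemma periodicGaussian_add_mul_I {lam : ℝ} (hlam : 0 < lam) (u : ℂ) (l : ℕ) :
    periodicGaussian lam (u + I * l / lam) =
      exp (-2 * Real.pi * I * l * u + Real.pi * l ^ 2 / lam) * periodicGaussian lam u := by
  have hl : (lam : ℂ) ≠ 0 := by exact_mod_cast hlam.ne'
  have hper : Function.Periodic (fun z => jacobiTheta₂ z (I * lam)) 1 :=
    fun z => jacobiTheta₂_add_left z _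
  have h := hper.nat_mul l (-I * lam * u)
  simp only [mul_one] at h
  unfold periodicGaussian
  rw [show -I * lam * (u + I * l / lam) = -I * lam * u + l by
    field_simp; linear_combination (-(l : ℂ)) * I_sq, h, ← mul_assoc, ← exp_add]
  congr 2
  field_simp
  linear_combination (-(l : ℂ) ^ 2) * I_sq

lemma gaussianWindow_apply (N : ℕ) (lam : ℝ) (n : Fin N) :
    gaussianWindow N lam n = periodicGaussian lam ((n : ℕ) / N) := by
  change (∑' j : ℤ, dilatedGaussian lam (((n : ℕ) : ℝ) / (N : ℝ) - (j : ℝ))) = _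
  unfold periodicGaussian jacobiTheta₂
  rw [← tsum_mul_left]
  refine tsum_congr fun j => ?_
  unfold dilatedGaussian jacobiTheta₂_term
  push_cast
  rw [← exp_add]
  congr 1
  linear_combination (2 * Real.pi * j * lam * ((n : ℕ) / N) - Real.pi * j ^ 2 * lam) * I_sq

lemma gaussianWindow_eq_ofReal (N : ℕ) (lam : ℝ) (n : Fin N) :
    gaussianWindow N lam n =
      ((∑' j : ℤ, Real.exp (-Real.pi * lam * (((n : ℕ) : ℝ) / (N : ℝ) - (j : ℝ)) ^ 2) : ℝ) : ℂ) := by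
  rw [ofReal_tsum]
  rfl

lemma conj_gaussianWindow (N : ℕ) (lam : ℝ) (n : Fin N) :
    (starRingEnd ℂ) (gaussianWindow N lam n) = gaussianWindow N lam n := by
  rw [gaussianWindow_eq_ofReal, conj_ofReal]

lemma gaussianWindow_ne_zero (N : ℕ) {lam : ℝ} (hlam : 0 < lam) (n : Fin N) :
    gaussianWindow N lam n ≠ 0 := by
  have hs : Summable fun j : ℤ =>
      Real.exp (-Real.pi * lam * (((n : ℕ) : ℝ) / (N : ℝ) - (j : ℝ)) ^ 2) := by
    have him : 0 < (I * lam : ℂ).im := by simpa using hlam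
    have h := ((summable_jacobiTheta₂_term_iff (-I * lam * ((n : ℕ) / N)) (I * lam)).mpr him).mul_left
      (exp (-Real.pi * lam * ((n : ℕ) / N) ^ 2))
    refine (h.norm).congr fun j => ?_
    have e : exp (-Real.pi * lam * ((n : ℕ) / N) ^ 2) *
        jacobiTheta₂_term j (-I * lam * ((n : ℕ) / N)) (I * lam) =
        ((Real.exp (-Real.pi * lam * (((n : ℕ) : ℝ) / (N : ℝ) - (j : ℝ)) ^ 2) : ℝ) : ℂ) := by
      unfold jacobiTheta₂_term
      push_cast
      rw [← exp_add]
      congr 1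
      linear_combination (-(2 * Real.pi * j * lam * ((n : ℕ) / N) - Real.pi * j ^ 2 * lam)) * I_sq
    rw [e, norm_real, Real.norm_of_nonneg (Real.exp_pos _).le]
  rw [gaussianWindow_eq_ofReal, ofReal_ne_zero]
  exact (hs.tsum_pos (fun _ => (Real.exp_pos _).le) 0 (Real.exp_pos _)).ne'

lemma exists_val_sub_eq {N : ℕ} (m k : Fin N) :
    ∃ j : ℤ, (((m - k : Fin N) : ℕ) : ℂ) = (m : ℕ) - (k : ℕ) + N * j := by
  obtain ⟨j, hj⟩ : ∃ j : ℤ, (((m - k : Fin N) : ℕ) : ℤ) = (m : ℕ) - (k : ℕ) + N * j := by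
    rcases le_or_gt k m with h | h
    · refine ⟨0, ?_⟩
      rw [Fin.sub_val_of_le h, Nat.cast_sub h]
      ring
    · refine ⟨1, ?_⟩
      have h1 := Fin.coe_sub_iff_lt.mpr h
      have h2 := k.isLt
      rw [h1]
      omega
  refine ⟨j, ?_⟩
  exact_mod_cast congrArg (Int.cast : ℤ → ℂ) hj

/-- The entire function whose values at the points `k / N - i l / lam` are, up to nonzero factors,
the values `V_h f [k, l]` of the Gabor transform with Gaussian window. -/
noncomputable def gaborTheta {N : ℕ} (lam : ℝ) (f : EuclideanSpace ℂ (Fin N)) (z : ℂ) : ℂ :=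
  ∑ m : Fin N, f m * periodicGaussian lam ((m : ℕ) / N - z)

/-- The point `k / N - i l / lam` of the complex plane at which the index pair `(k, l)` samples. -/
noncomputable def gaborPoint {N : ℕ} (lam : ℝ) (x : Fin N × Fin N) : ℂ :=
  (x.1 : ℕ) / N - I * (x.2 : ℕ) / lam

lemma isThetaSection_gaborTheta {N : ℕ} (hN : 1 ≤ N) {lam : ℝ} (hlam : 0 < lam)
    (f : EuclideanSpace ℂ (Fin N)) :
    IsThetaSection (I * N / lam) N (exp (Real.pi * N ^ 2 / lam)) (gaborTheta lam f) := by
  have hd := differentiable_periodicGaussian hlam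
  have hN0 : (N : ℂ) ≠ 0 := by exact_mod_cast (by omega : N ≠ 0)
  refine ⟨?_, fun z => ?_, fun z => ?_⟩
  · unfold gaborTheta
    fun_prop
  · unfold gaborTheta
    refine Finset.sum_congr rfl fun m _ => ?_
    rw [← periodicGaussian_add_one lam ((m : ℕ) / N - (z + 1))]
    ring_nf
  · unfold gaborTheta
    rw [Finset.mul_sum]
    refine Finset.sum_congr rfl fun m _ => ?_
    have h := periodicGaussian_add_mul_I hlam ((m : ℕ) / N - (z + I * N / lam)) N
    rw [show (m : ℕ) / N - (z + I * N / lam) + I * N / lam = (m : ℕ) / N - z by ring] at h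
    rw [h]
    have hl : (lam : ℂ) ≠ 0 := by exact_mod_cast hlam.ne'
    have e : exp (Real.pi * N ^ 2 / lam) * exp (-(2 * Real.pi * I * N * z)) *
        exp (-2 * Real.pi * I * N * ((m : ℕ) / N - (z + I * N / lam)) + Real.pi * N ^ 2 / lam) =
        1 := by
      rw [← exp_add, ← exp_add, exp_eq_one_iff]
      refine ⟨-(m : ℕ), ?_⟩
      push_cast
      field_simp
      linear_combination (2 * (N : ℂ) ^ 2) * I_sq
    linear_combination (-(f m) * periodicGaussian lam ((m : ℕ) / N - (z + I * N / lam))) * e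

lemma gaborTheta_gaborPoint {N : ℕ} {lam : ℝ} (hlam : 0 < lam)
    (f : EuclideanSpace ℂ (Fin N)) (x : Fin N × Fin N) :
    gaborTheta lam f (gaborPoint lam x) =
      exp (2 * Real.pi * I * (x.2 : ℕ) * (x.1 : ℕ) / N + Real.pi * (x.2 : ℕ) ^ 2 / lam) *
        gaborTransform (gaussianWindow N lam) f x.1 x.2 := by
  unfold gaborTheta gaborTransform gaborPoint
  rw [Finset.mul_sum]
  refine Finset.sum_congr rfl fun m _ => ?_
  have hN0 : (N : ℂ) ≠ 0 := by
    have := m.isLt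
    exact_mod_cast (by omega : N ≠ 0)
  obtain ⟨j, hj⟩ := exists_val_sub_eq m x.1
  rw [conj_gaussianWindow, gaussianWindow_apply, hj,
    show ((m : ℕ) - (x.1 : ℕ) + N * j : ℂ) / N = ((m : ℕ) - (x.1 : ℕ)) / N + j by field_simp,
    periodicGaussian_add_intCast,
    show (m : ℕ) / N - ((x.1 : ℕ) / N - I * (x.2 : ℕ) / lam) =
      ((m : ℕ) - (x.1 : ℕ) : ℂ) / N + I * (x.2 : ℕ) / lam by ring,
    periodicGaussian_add_mul_I hlam]
  have e : exp (-2 * Real.pi * I * (x.2 : ℕ) * (((m : ℕ) - (x.1 : ℕ) : ℂ) / N) +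
        Real.pi * (x.2 : ℕ) ^ 2 / lam) =
      exp (2 * Real.pi * I * (x.2 : ℕ) * (x.1 : ℕ) / N + Real.pi * (x.2 : ℕ) ^ 2 / lam) *
        exp (-2 * Real.pi * I * (x.2 : ℕ) * (m : ℕ) / N) := by
    rw [← exp_add]
    ring_nf
  rw [e]
  ring

lemma gaborTheta_gaborPoint_eq_zero_iff {N : ℕ} {lam : ℝ} (hlam : 0 < lam)
    (f : EuclideanSpace ℂ (Fin N)) (x : Fin N × Fin N) :
    gaborTheta lam f (gaborPoint lam x) = 0 ↔
      gaborTransform (gaussianWindow N lam) f x.1 x.2 = 0 := by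
  rw [gaborTheta_gaborPoint hlam]
  simp

lemma eq_of_sub_eq_mul {N a b : ℕ} (ha : a < N) (hb : b < N) {m : ℤ}
    (h : (a : ℤ) - b = m * N) : a = b := by
  have hm : m = 0 := by
    by_contra hm
    rcases lt_or_gt_of_ne hm with h' | h' <;> nlinarith
  subst hm
  omega

lemma gaborPoint_sub_ne {N : ℕ} (hN : 1 ≤ N) {lam : ℝ} (hlam : 0 < lam)
    {x y : Fin N × Fin N} (hxy : x ≠ y) (m k : ℤ) :
    gaborPoint lam x - gaborPoint lam y ≠ m + k * (I * N / lam) := by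
  intro h
  have hN0 : (N : ℂ) ≠ 0 := by exact_mod_cast (by omega : N ≠ 0)
  have hl : (lam : ℂ) ≠ 0 := by exact_mod_cast hlam.ne'
  unfold gaborPoint at h
  field_simp at h
  apply hxy
  have h1 := congrArg Complex.re h
  have h2 := congrArg Complex.im h
  simp at h1 h2
  have hNr : (N : ℝ) ≠ 0 := by exact_mod_cast (by omega : N ≠ 0)
  have h1' : ((x.1 : ℕ) : ℝ) - (y.1 : ℕ) = m * N :=
    mul_right_cancel₀ hlam.ne' (by linear_combination h1)
  have h2' : ((y.2 : ℕ) : ℝ) - (x.2 : ℕ) = k * N :=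
    mul_right_cancel₀ hNr (by linear_combination h2)
  refine Prod.ext (Fin.ext ?_) (Fin.ext ?_)
  · exact eq_of_sub_eq_mul x.1.isLt y.1.isLt (m := m) (by exact_mod_cast h1')
  · exact (eq_of_sub_eq_mul y.2.isLt x.2.isLt (m := k) (by exact_mod_cast h2')).symm

/-- A vector is recovered from its full Gabor transform: for fixed first index the transform is a
Vandermonde system in the products `f m * h (m - k)`, and `h` has no zeros. -/
lemma eq_zero_of_gaborTheta_eq_zero {N : ℕ} {lam : ℝ} (hlam : 0 < lam)
    {f : EuclideanSpace ℂ (Fin N)} (h : ∀ z, gaborTheta lam f z = 0) : f = 0 := by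
  ext k
  have hN0 : (N : ℂ) ≠ 0 := by
    have := k.isLt
    exact_mod_cast (by omega : N ≠ 0)
  have hV : ∀ l : Fin N, gaborTransform (gaussianWindow N lam) f k l = 0 := fun l =>
    (gaborTheta_gaborPoint_eq_zero_iff hlam f (k, l)).mp (h _)
  have hinj : Function.Injective fun m : Fin N => exp (-2 * Real.pi * I * (m : ℕ) / N) := by
    intro a b hab
    obtain ⟨n, hn⟩ := exp_eq_exp_iff_exists_int.mp hab
    field_simp at hn
    have hpi := two_pi_I_ne_zero
    have h2 : ((b : ℕ) : ℂ) - (a : ℕ) = n * N :=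
      mul_left_cancel₀ hpi (by linear_combination (2 * Real.pi * I) * hn)
    exact Fin.ext (eq_of_sub_eq_mul b.isLt a.isLt (m := n) (by exact_mod_cast h2)).symm
  have hv := Matrix.eq_zero_of_forall_pow_sum_mul_pow_eq_zero
    (v := fun m => f m * (starRingEnd ℂ) (gaussianWindow N lam (m - k))) hinj (fun l => by
      rw [← hV l]
      unfold gaborTransform
      refine Finset.sum_congr rfl fun m _ => ?_
      rw [← exp_nat_mul]
      congr 2
      ring)
  have hk := congrFun hv k
  rw [conj_gaussianWindow] at hk
  exact (mul_eq_zero.mp hk).resolve_right (gaussianWindow_ne_zero N hlam _)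

/-! ### Frames and the kernel of the analysis operator -/

lemma gaborTransform_add {N : ℕ} (g f₁ f₂ : EuclideanSpace ℂ (Fin N)) (k l : Fin N) :
    gaborTransform g (f₁ + f₂) k l = gaborTransform g f₁ k l + gaborTransform g f₂ k l := by
  simp [gaborTransform, add_mul, Finset.sum_add_distrib]

lemma gaborTransform_smul {N : ℕ} (g f : EuclideanSpace ℂ (Fin N)) (a : ℂ) (k l : Fin N) :
    gaborTransform g (a • f) k l = a * gaborTransform g f k l := by
  simp [gaborTransform, Finset.mul_sum, mul_assoc]

/-- The analysis operator `f ↦ (V_g f [p i])_i`. -/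
noncomputable def analysisMap {N : ℕ} {ι : Type*} (g : EuclideanSpace ℂ (Fin N))
    (p : ι → Fin N × Fin N) : EuclideanSpace ℂ (Fin N) →ₗ[ℂ] EuclideanSpace ℂ ι where
  toFun f := WithLp.toLp 2 fun i => gaborTransform g f (p i).1 (p i).2
  map_add' f₁ f₂ := by
    ext i
    simp [gaborTransform_add]
  map_smul' a f := by
    ext i
    simp [gaborTransform_smul]

lemma norm_sq_analysisMap {N K : ℕ} (g f : EuclideanSpace ℂ (Fin N))
    (p : Fin K → Fin N × Fin N) :
    ‖analysisMap g p f‖ ^ 2 = ∑ k : Fin K, ‖gaborTransform g f (p k).1 (p k).2‖ ^ 2 := by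
  rw [EuclideanSpace.norm_sq_eq]
  rfl

/-- In finite dimension, the frame inequalities amount to injectivity of the analysis operator. -/
lemma isGaborFrame_iff {N K : ℕ} (g : EuclideanSpace ℂ (Fin N)) (p : Fin K → Fin N × Fin N) :
    IsGaborFrame g p ↔
      ∀ f, (∀ k, gaborTransform g f (p k).1 (p k).2 = 0) → f = 0 := by
  constructor
  · rintro ⟨A, B, hA, -, h⟩ f hf
    have h1 := (h f).1
    simp only [hf, norm_zero, ne_eq, OfNat.ofNat_ne_zero, not_false_eq_true, zero_pow,
      Finset.sum_const_zero] at h1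
    by_contra hne
    have : 0 < A * ‖f‖ ^ 2 := mul_pos hA (pow_pos (norm_pos_iff.mpr hne) 2)
    linarith
  · intro h
    have hker : LinearMap.ker (analysisMap g p) = ⊥ := by
      refine (LinearMap.ker_eq_bot').mpr fun f hf => h f fun k => ?_
      exact congrArg (fun v : EuclideanSpace ℂ (Fin K) => v k) hf
    obtain ⟨C, hC, hanti⟩ := LinearMap.exists_antilipschitzWith _ hker
    have hC' : (0 : ℝ) < C := hC
    set T : EuclideanSpace ℂ (Fin N) →L[ℂ] EuclideanSpace ℂ (Fin K) :=
      LinearMap.toContinuousLinearMap (analysisMap g p) with hT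
    refine ⟨((C : ℝ) ^ 2)⁻¹, ‖T‖ ^ 2 + 1, by positivity, by positivity, fun f => ?_⟩
    rw [← norm_sq_analysisMap]
    constructor
    · have h1 : ‖f‖ ≤ C * ‖analysisMap g p f‖ := by
        simpa using hanti.le_mul_dist f 0
      rw [inv_mul_le_iff₀ (by positivity), ← mul_pow]
      gcongr
    · have h1 : ‖analysisMap g p f‖ ≤ ‖T‖ * ‖f‖ := T.le_opNorm f
      calc ‖analysisMap g p f‖ ^ 2 ≤ (‖T‖ * ‖f‖) ^ 2 := by gcongr
        _ ≤ (‖T‖ ^ 2 + 1) * ‖f‖ ^ 2 := by nlinarith [sq_nonneg ‖f‖]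

/-- Fewer than `N` samples of the Gabor transform annihilate a nonzero vector, by counting
dimensions. -/
lemma exists_ne_zero_gaborTransform_eq_zero {N : ℕ} {ι : Type*} (g : EuclideanSpace ℂ (Fin N))
    (p : ι → Fin N × Fin N) (s : Finset ι) (hs : s.card < N) :
    ∃ f ≠ 0, ∀ i ∈ s, gaborTransform g f (p i).1 (p i).2 = 0 := by
  have hker : LinearMap.ker (analysisMap g fun i : s => p i) ≠ ⊥ :=
    LinearMap.ker_ne_bot_of_finrank_lt (by simpa using hs)
  obtain ⟨f, hf, hne⟩ := Submodule.exists_mem_ne_zero_of_ne_bot hker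
  refine ⟨f, hne, fun i hi => ?_⟩
  exact congrArg (fun v : EuclideanSpace ℂ s => v ⟨i, hi⟩) (LinearMap.mem_ker.mp hf)

/-! ### The sum of the sampling points -/

/-- Comparing real and imaginary parts of the exponents, the condition on the sum of `N` zeros
becomes a pair of integer equations. -/
lemma zero_sum_condition_iff {N : ℕ} (hN : 1 ≤ N) {lam : ℝ} (hlam : 0 < lam) (a b : ℕ) (k : ℤ) :
    (-1) ^ N * exp (Real.pi * N ^ 2 / lam) *
        exp (-(2 * Real.pi * I * ((a : ℂ) / N - I * b / lam))) =
      exp (2 * Real.pi * I * (k * (I * N / lam))) ↔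
    ((N : ℤ) ^ 2 = 2 * b - 2 * k * N ∧ ∃ n : ℤ, (N : ℤ) ^ 2 = 2 * a + 2 * n * N) := by
  have hN0 : (N : ℂ) ≠ 0 := by exact_mod_cast (by omega : N ≠ 0)
  have hl : (lam : ℂ) ≠ 0 := by exact_mod_cast hlam.ne'
  have hpi : (Real.pi : ℂ) ≠ 0 := by exact_mod_cast Real.pi_ne_zero
  have hneg : ((-1 : ℂ)) ^ N = exp (N * (Real.pi * I)) := by rw [exp_nat_mul, exp_pi_mul_I]
  rw [hneg, ← exp_add, ← exp_add, exp_eq_exp_iff_exists_int]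
  have key : ∀ n : ℤ, (N * (Real.pi * I) + Real.pi * N ^ 2 / lam +
      -(2 * Real.pi * I * ((a : ℂ) / N - I * b / lam)) =
      2 * Real.pi * I * (k * (I * N / lam)) + n * (2 * Real.pi * I)) ↔
      ((N : ℤ) ^ 2 = 2 * b - 2 * k * N ∧ (N : ℤ) ^ 2 = 2 * a + 2 * n * N) := by
    intro n
    constructor
    · intro h
      have h' : (N : ℂ) * ((N : ℂ) ^ 2 - 2 * b + 2 * k * N) +
          lam * ((N : ℂ) ^ 2 - 2 * a - 2 * n * N) * I = 0 := by
        refine mul_left_cancel₀ hpi ?_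
        field_simp at h
        linear_combination Real.pi * h +
          Real.pi * (-2 * (N : ℂ) * b + 2 * k * (N : ℂ) ^ 2) * I_sq
      have h1 := congrArg Complex.re h'
      have h2 := congrArg Complex.im h'
      have e : (N : ℂ) * ((N : ℂ) ^ 2 - 2 * b + 2 * k * N) +
          lam * ((N : ℂ) ^ 2 - 2 * a - 2 * n * N) * I =
          (((N : ℝ) * ((N : ℝ) ^ 2 - 2 * b + 2 * k * N) : ℝ) : ℂ) +
          ((lam * ((N : ℝ) ^ 2 - 2 * a - 2 * n * N) : ℝ) : ℂ) * I := by push_cast; ring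
      rw [e, add_re, ofReal_re, re_ofReal_mul, I_re, mul_zero, add_zero, zero_re] at h1
      rw [e, add_im, ofReal_im, im_ofReal_mul, I_im, mul_one, zero_add, zero_im] at h2
      have hNr : (N : ℝ) ≠ 0 := by exact_mod_cast (by omega : N ≠ 0)
      have h3 := (mul_eq_zero.mp h1).resolve_left hNr
      have h4 := (mul_eq_zero.mp h2).resolve_left hlam.ne'
      have h3' : (N : ℤ) ^ 2 - 2 * b + 2 * k * N = 0 := by exact_mod_cast h3
      have h4' : (N : ℤ) ^ 2 - 2 * a - 2 * n * N = 0 := by exact_mod_cast h4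
      exact ⟨by linear_combination h3', by linear_combination h4'⟩
    · rintro ⟨h1, h2⟩
      have h1' : (N : ℂ) ^ 2 = 2 * b - 2 * k * N := by exact_mod_cast congrArg (Int.cast : ℤ → ℂ) h1
      have h2' : (N : ℂ) ^ 2 = 2 * a + 2 * n * N := by exact_mod_cast congrArg (Int.cast : ℤ → ℂ) h2
      field_simp
      linear_combination (N : ℂ) * h1' + lam * I * h2' + (2 * (N : ℂ) * b - 2 * k * (N : ℂ) ^ 2) * I_sq
  simp only [key]
  constructor
  · rintro ⟨n, h1, h2⟩
    exact ⟨h1, n, h2⟩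
  · rintro ⟨h1, n, h2⟩
    exact ⟨n, h1, h2⟩

lemma zero_sum_integer_condition_iff {N : ℕ} (a b : ℕ) :
    (∃ k : ℤ, (N : ℤ) ^ 2 = 2 * b - 2 * k * N ∧ ∃ n : ℤ, (N : ℤ) ^ 2 = 2 * a + 2 * n * N) ↔
      Even N ∧ N ∣ a ∧ N ∣ b := by
  constructor
  · rintro ⟨k, h1, n, h2⟩
    have hev : Even N := by
      have : Even ((N : ℤ) ^ 2) := ⟨b - k * N, by linear_combination h1⟩
      exact_mod_cast (Int.even_pow.mp this).1
    obtain ⟨M, hM⟩ := hev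
    have hM' : (N : ℤ) = M + M := by exact_mod_cast hM
    refine ⟨⟨M, hM⟩, ?_, ?_⟩
    · refine Int.natCast_dvd_natCast.mp ⟨M - n, ?_⟩
      have : 2 * (a : ℤ) = 2 * (N * (M - n)) := by linear_combination -h2 + N * hM'
      exact mul_left_cancel₀ two_ne_zero this
    · refine Int.natCast_dvd_natCast.mp ⟨M + k, ?_⟩
      have : 2 * (b : ℤ) = 2 * (N * (M + k)) := by linear_combination -h1 + N * hM'
      exact mul_left_cancel₀ two_ne_zero this
  · rintro ⟨⟨M, hM⟩, ⟨a', rfl⟩, ⟨b', rfl⟩⟩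
    have hM' : (N : ℤ) = M + M := by exact_mod_cast hM
    refine ⟨b' - M, ?_, M - a', ?_⟩
    · push_cast
      linear_combination N * hM'
    · push_cast
      linear_combination N * hM'

lemma sum_gaborPoint {N : ℕ} {ι : Type*} (lam : ℝ) (p : ι → Fin N × Fin N) (s : Finset ι) :
    ∑ i ∈ s, gaborPoint lam (p i) =
      ((∑ i ∈ s, ((p i).1 : ℕ) : ℕ) : ℂ) / N - I * ((∑ i ∈ s, ((p i).2 : ℕ) : ℕ) : ℂ) / lam := by
  unfold gaborPoint
  push_cast
  rw [Finset.sum_sub_distrib, Finset.sum_div, Finset.mul_sum, Finset.sum_div]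

end FiniteGabor

open FiniteGabor in
theorem theorem2 (N : ℕ) (hN : 1 ≤ N) (lam : ℝ) (hlam : 0 < lam) (K : ℕ)
    (p : Fin K → Fin N × Fin N) (hp : Function.Injective p) :
    FiniteGabor.IsGaborFrame (FiniteGabor.gaussianWindow N lam) p ↔
      ((K ≤ N ^ 2 ∧ N + 1 ≤ K) ∨
        (K = N ∧ Odd N) ∨
        (K = N ∧ Even N ∧
          ¬ ∃ a b : ℕ, ∑ k : Fin K, ((p k).1 : ℕ) = N * a ∧
            ∑ k : Fin K, ((p k).2 : ℕ) = N * b)) := by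
  have hKN : K ≤ N ^ 2 := by
    have := Fintype.card_le_of_injective p hp
    simpa [sq] using this
  have hτ : 0 < (Complex.I * N / lam : ℂ).im := by
    have : (Complex.I * N / lam : ℂ) = ((N / lam : ℝ) : ℂ) * Complex.I := by push_cast; ring
    rw [this, Complex.im_ofReal_mul, Complex.I_im, mul_one]
    have : (0 : ℝ) < N := by exact_mod_cast hN
    positivity
  have hz : ∀ i j : Fin K, i ≠ j → ∀ m k : ℤ,
      gaborPoint lam (p i) - gaborPoint lam (p j) ≠ m + k * (Complex.I * N / lam) :=
    fun i j hij m k => gaborPoint_sub_ne hN hlam (fun e => hij (hp e)) m k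
  have hdvd : (∃ a b : ℕ, ∑ k : Fin K, ((p k).1 : ℕ) = N * a ∧
      ∑ k : Fin K, ((p k).2 : ℕ) = N * b) ↔
      N ∣ ∑ k : Fin K, ((p k).1 : ℕ) ∧ N ∣ ∑ k : Fin K, ((p k).2 : ℕ) :=
    ⟨fun ⟨a, b, h1, h2⟩ => ⟨⟨a, h1⟩, ⟨b, h2⟩⟩, fun ⟨⟨a, h1⟩, ⟨b, h2⟩⟩ => ⟨a, b, h1, h2⟩⟩
  rw [isGaborFrame_iff, hdvd]
  constructor
  · intro hframe
    have hge : N ≤ K := by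
      by_contra! hlt
      obtain ⟨f, hne, hf⟩ := exists_ne_zero_gaborTransform_eq_zero (gaussianWindow N lam) p
        Finset.univ (by simpa using hlt)
      exact hne (hframe f fun k => hf k (Finset.mem_univ k))
    rcases hge.lt_or_eq with hlt | rfl
    · exact Or.inl ⟨hKN, hlt⟩
    rcases Nat.even_or_odd N with hev | hodd
    · refine Or.inr (Or.inr ⟨rfl, hev, fun hsum => ?_⟩)
      -- `f` vanishes at all points but one, and the sum condition forces it to vanish there too.
      set a : Fin N := ⟨0, hN⟩
      have hcard : (Finset.univ.erase a).card + 1 = N := by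
        rw [Finset.card_erase_add_one (Finset.mem_univ a)]; simp
      obtain ⟨f, hne, hf⟩ := exists_ne_zero_gaborTransform_eq_zero (gaussianWindow N lam) p
        (Finset.univ.erase a) (by omega)
      refine hne (hframe f fun k => ?_)
      by_cases hk : k = a
      · obtain ⟨j, hj⟩ := (zero_sum_integer_condition_iff _ _).mpr ⟨hev, hsum⟩
        have hj' := (zero_sum_condition_iff hN hlam _ _ j).mpr hj
        rw [← sum_gaborPoint] at hj'
        rw [hk, ← gaborTheta_gaborPoint_eq_zero_iff hlam]
        refine IsThetaSection.eq_zero_of_sum_zeros hτ (fun i => gaborPoint lam (p i)) hz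
          (Finset.univ.erase a) (Finset.notMem_erase a _) (c := Complex.exp (Real.pi * N ^ 2 / lam))
          (F := gaborTheta lam f) (k := j) ?_ ?_ ?_
        · rw [hcard]
          exact isThetaSection_gaborTheta hN hlam f
        · exact fun i hi => (gaborTheta_gaborPoint_eq_zero_iff hlam f _).mpr (hf i hi)
        · rw [hcard, Finset.insert_erase (Finset.mem_univ a)]
          exact hj'
      · exact hf k (Finset.mem_erase.mpr ⟨hk, Finset.mem_univ k⟩)
    · exact Or.inr (Or.inl ⟨rfl, hodd⟩)
  · intro hcond f hf
    refine eq_zero_of_gaborTheta_eq_zero hlam ?_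
    have hNK : N ≤ K := by omega
    obtain ⟨s, -, hs⟩ := Finset.exists_subset_card_eq (s := (Finset.univ : Finset (Fin K)))
      (n := N) (by simpa using hNK)
    have hzero : ∀ i, gaborTheta lam f (gaborPoint lam (p i)) = 0 :=
      fun i => (gaborTheta_gaborPoint_eq_zero_iff hlam f _).mpr (hf i)
    have hsec := isThetaSection_gaborTheta hN hlam f
    rcases IsThetaSection.eq_zero_or_of_card_zeros hτ (fun i => gaborPoint lam (p i)) hz s
      (by rw [hs]; exact hsec) (fun i _ => hzero i) with h | ⟨hout, j, hj⟩
    · exact h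
    exfalso
    have hall : s = Finset.univ := Finset.eq_univ_of_forall fun i => by
      by_contra hi
      exact hout i hi (hzero i)
    have hKN' : K = N := by rw [← hs, hall]; simp
    rw [sum_gaborPoint, hs, hall] at hj
    obtain ⟨hev, hd⟩ := (zero_sum_integer_condition_iff _ _).mp
      ⟨j, (zero_sum_condition_iff hN hlam _ _ j).mp hj⟩
    rcases hcond with ⟨-, h⟩ | ⟨-, h⟩ | ⟨-, -, h⟩
    · omega
    · exact (Nat.not_even_iff_odd.mpr h) hev
    · exact h hd
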